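/- For $p>0$ let $\beta_p = 2\Gamma(1+1/p)$ and let $Y_1^{(p)}, \dots, Y_n^{(p)}$ be i.i.d. real random variables with density $x\mapsto e^{-\beta_p^p|x|^p}$ on $\mathbb{R}$, where for any $p_1,\dots,p_n>0$ the variables $Y_1^{(p_1)},\dots,Y_n^{(p_n)}$ are independent. Let $\|\cdot\|$ be any norm on $\mathbb{R}^k$, let $v_1,\dots,v_n\in\mathbb{R}^k$ be arbitrary vectors, and let $-k<q<0$. Then the function $$(p_1,\dots,p_n)\mapsto \mathbb{E}\Big\|\sum_{j=1}^n Y_j^{(p_j)}v_j\Big\|^q \in [0,+\infty], \qquad p_1,\dots,p_n\in(0,\infty),$$ (with the convention $0^q=+\infty$) is nondecreasing in each variable. -/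

import Mathlib

open MeasureTheory ProbabilityTheory

noncomputable section

/-- The constant `β_p = 2 Γ(1 + 1/p)`. -/
def betaConst (p : ℝ) : ℝ := 2 * Real.Gamma (1 + 1 / p)

/-- The probability measure on `ℝ` with density `x ↦ exp (-β_p ^ p * |x| ^ p)`, for `p > 0`. -/
def expPowerMeasure (p : ℝ) : Measure ℝ :=
  (volume : Measure ℝ).withDensity
    (fun x => ENNReal.ofReal (Real.exp (-(betaConst p ^ p * |x| ^ p))))

/-- The expectation `E N(∑ j, X j • v j) ^ q`, as an element of `[0, ∞]`; in `[0, ∞]` one has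
`0 ^ q = ∞` for `q < 0`. -/
def expNormPow {Ω : Type*} [MeasurableSpace Ω] (P : Measure Ω) {n k : ℕ}
    (N : Seminorm ℝ (EuclideanSpace ℝ (Fin k))) (v : Fin n → EuclideanSpace ℝ (Fin k)) (q : ℝ)
    (X : Fin n → Ω → ℝ) : ENNReal :=
  ∫⁻ ω, ENNReal.ofReal (N (∑ j, X j ω • v j)) ^ q ∂P

end

section

open scoped ENNReal

/-! Raising one exponent makes that factor's law more peaked at 0, and peakedness raises the
expectation of any even quasi-concave function, here `N (∑ j, y j • v j) ^ q`.

Integrate out every coordinate but the `i`-th. By an Anderson-type theorem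
(`IsEvenQuasiconcave.lmarginal_le_lmarginal_smul`) what remains is a function of one real variable
that is nonincreasing in its absolute value. Two densities of the family have equal mass, and as
functions of `|x|` they cross once, so `lintegral_expPowerMeasure_mono` compares the integrals.

For `p < 1` the densities are not log-concave. The Anderson step therefore slices both the function
and the densities by layer cake into indicators of symmetric convex sets, and Prékopa's theorem, via
one-dimensional Brunn-Minkowski, integrates out one coordinate at a time. -/

/-! ### Brunn-Minkowski, layer cake and Prékopa-Leindler on the line. -/

lemma volume_add_volume_le_of_isCompact {K L C : Set ℝ} (hK : IsCompact K) (hL : IsCompact L)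
    (hK' : K.Nonempty) (hL' : L.Nonempty) (h : ∀ x ∈ K, ∀ y ∈ L, x + y ∈ C) :
    volume K + volume L ≤ volume C := by
  -- With `α = max K` and `β = min L`, the translates `K + β` and `α + L` lie in `C` and meet only
  -- at `α + β`.
  obtain ⟨α, hα, hα'⟩ := hK.exists_isGreatest hK'
  obtain ⟨β, hβ, hβ'⟩ := hL.exists_isLeast hL'
  have h1 : volume ((fun x => x + β) '' K) = volume K := by
    simp
  have h2 : volume ((fun x => α + x) '' L) = volume L := by
    simp
  have hsub : ((fun x => x + β) '' K) ∪ ((fun x => α + x) '' L) ⊆ C := by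
    rintro _ (⟨x, hx, rfl⟩ | ⟨y, hy, rfl⟩)
    · exact h x hx β hβ
    · exact h α hα y hy
  have hm : MeasurableSet ((fun x => α + x) '' L) :=
    (hL.image (by fun_prop)).measurableSet
  have hd : AEDisjoint volume ((fun x => x + β) '' K) ((fun x => α + x) '' L) := by
    refine measure_mono_null (t := {α + β}) ?_ (by simp)
    rintro z ⟨⟨x, hx, rfl⟩, ⟨y, hy, hxy⟩⟩
    have := hα' hx
    have := hβ' hy
    simp only at hxy
    simp only [Set.mem_singleton_iff]
    linarith
  rw [← h1, ← h2, ← measure_union₀ hm.nullMeasurableSet hd]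
  exact measure_mono hsub

/-- The one-dimensional Brunn-Minkowski inequality. -/
lemma volume_add_volume_le {A B C : Set ℝ} (hA : MeasurableSet A) (hB : MeasurableSet B)
    (hA' : A.Nonempty) (hB' : B.Nonempty) (h : ∀ x ∈ A, ∀ y ∈ B, x + y ∈ C) :
    volume A + volume B ≤ volume C := by
  obtain ⟨a, ha⟩ := hA'
  obtain ⟨b, hb⟩ := hB'
  rw [hA.measure_eq_iSup_isCompact, hB.measure_eq_iSup_isCompact]
  simp only [iSup_and']
  refine ENNReal.biSup_add_biSup_le' ⟨∅, by simp⟩ ⟨∅, by simp⟩ ?_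
  rintro K ⟨hKA, hK⟩ L ⟨hLB, hL⟩
  -- The approximating compacts may be empty; adjoining `a` and `b` makes them nonempty.
  refine (add_le_add (measure_mono (Set.subset_insert a K))
    (measure_mono (Set.subset_insert b L))).trans ?_
  refine volume_add_volume_le_of_isCompact (hK.insert a) (hL.insert b) (Set.insert_nonempty _ _)
    (Set.insert_nonempty _ _) fun x hx y hy => h x ?_ y ?_
  · exact Set.insert_subset ha hKA hx
  · exact Set.insert_subset hb hLB hy

lemma volume_smul_add_volume_smul_le {A B C : Set ℝ} (hA : MeasurableSet A) (hB : MeasurableSet B)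
    (hA' : A.Nonempty) (hB' : B.Nonempty) {a b : ℝ} (ha : 0 < a) (hb : 0 < b)
    (h : ∀ x ∈ A, ∀ y ∈ B, a * x + b * y ∈ C) :
    ENNReal.ofReal a * volume A + ENNReal.ofReal b * volume B ≤ volume C := by
  have key : ∀ (c : ℝ), 0 < c → ∀ S : Set ℝ,
      volume ((fun x => c * x) '' S) = ENNReal.ofReal c * volume S := by
    intro c hc S
    have := Measure.addHaar_smul (volume : Measure ℝ) c S
    rw [Module.finrank_self, pow_one, abs_of_pos hc] at this
    exact this
  have hmeas : ∀ (c : ℝ), 0 < c → ∀ S : Set ℝ, MeasurableSet S →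
      MeasurableSet ((fun x => c * x) '' S) := by
    intro c hc S hS
    exact (Homeomorph.mulLeft₀ c hc.ne').measurableEmbedding.measurableSet_image' hS
  rw [← key a ha, ← key b hb]
  refine volume_add_volume_le (hmeas a ha A hA) (hmeas b hb B hB) (hA'.image _) (hB'.image _) ?_
  rintro _ ⟨x, hx, rfl⟩ _ ⟨y, hy, rfl⟩
  exact h x hx y hy

lemma ENNReal.lintegral_Ioi_indicator_lt (c : ℝ≥0∞) :
    ∫⁻ s in Set.Ioi (0 : ℝ), {s : ℝ | ENNReal.ofReal s < c}.indicator 1 s = c := by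
  have hm : MeasurableSet {s : ℝ | ENNReal.ofReal s < c} :=
    measurableSet_lt (by fun_prop) measurable_const
  rw [lintegral_indicator_one hm, Measure.restrict_apply hm]
  rcases eq_or_ne c ⊤ with rfl | hc
  · simp
  · have : {s : ℝ | ENNReal.ofReal s < c} ∩ Set.Ioi 0 = Set.Ioo 0 c.toReal := by
      ext s
      simp only [Set.mem_inter_iff, Set.mem_ofPred_eq, Set.mem_Ioi, Set.mem_Ioo]
      constructor
      · rintro ⟨h1, h2⟩
        exact ⟨h2, (ENNReal.ofReal_lt_iff_lt_toReal h2.le hc).1 h1⟩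
      · rintro ⟨h1, h2⟩
        exact ⟨(ENNReal.ofReal_lt_iff_lt_toReal h1.le hc).2 h2, h1⟩
    rw [this]
    simp [hc]

/-- Layer cake formula for a weighted integral. -/
lemma lintegral_mul_eq_lintegral_superlevel {α : Type*} [MeasurableSpace α] (μ : Measure α)
    [SFinite μ] {f g : α → ℝ≥0∞} (hf : Measurable f) (hg : Measurable g) :
    ∫⁻ u, f u * g u ∂μ =
      ∫⁻ s in Set.Ioi (0 : ℝ), ∫⁻ u in {u | ENNReal.ofReal s < f u}, g u ∂μ := by
  have hm : MeasurableSet {z : ℝ × α | ENNReal.ofReal z.1 < f z.2} :=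
    measurableSet_lt (by fun_prop) (by fun_prop)
  calc ∫⁻ u, f u * g u ∂μ
      = ∫⁻ u, (∫⁻ s in Set.Ioi (0 : ℝ),
          {z : ℝ × α | ENNReal.ofReal z.1 < f z.2}.indicator (fun z => g z.2) (s, u)) ∂μ := by
        refine lintegral_congr fun u => ?_
        conv_lhs => rw [← ENNReal.lintegral_Ioi_indicator_lt (f u)]
        rw [← lintegral_mul_const]
        · refine lintegral_congr fun s => ?_
          by_cases h : ENNReal.ofReal s < f u <;> simp [Set.indicator, h]
        · exact measurable_one.indicator (measurableSet_lt (by fun_prop) measurable_const)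
    _ = ∫⁻ s in Set.Ioi (0 : ℝ), ∫⁻ u,
          {z : ℝ × α | ENNReal.ofReal z.1 < f z.2}.indicator (fun z => g z.2) (s, u) ∂μ := by
        refine lintegral_lintegral_swap (Measurable.aemeasurable ?_)
        exact ((hg.comp measurable_snd).indicator hm).comp measurable_swap
    _ = _ := by
        refine lintegral_congr fun s => ?_
        rw [← lintegral_indicator (measurableSet_lt measurable_const hf)]
        rfl

lemma lintegral_eq_lintegral_superlevel {α : Type*} [MeasurableSpace α] (μ : Measure α)
    [SFinite μ] {f : α → ℝ≥0∞} (hf : Measurable f) :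
    ∫⁻ u, f u ∂μ = ∫⁻ s in Set.Ioi (0 : ℝ), μ {u | ENNReal.ofReal s < f u} := by
  simpa using lintegral_mul_eq_lintegral_superlevel μ hf measurable_one

lemma ENNReal.geom_mean_le_arith_mean2 {a b : ℝ} (ha : 0 < a) (hb : 0 < b) (hab : a + b = 1)
    (x y : ℝ≥0∞) : x ^ a * y ^ b ≤ ENNReal.ofReal a * x + ENNReal.ofReal b * y := by
  rcases eq_or_ne x ⊤ with rfl | hx
  · simp [ENNReal.mul_top, ha]
  rcases eq_or_ne y ⊤ with rfl | hy
  · simp [ENNReal.mul_top, hb]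
  lift x to NNReal using hx
  lift y to NNReal using hy
  lift a to NNReal using ha.le
  lift b to NNReal using hb.le
  have := ENNReal.coe_le_coe.2
    (NNReal.geom_mean_le_arith_mean2_weighted a b x y (by exact_mod_cast hab))
  push_cast at this
  rw [ENNReal.ofReal_coe_nnreal, ENNReal.ofReal_coe_nnreal]
  rwa [ENNReal.coe_rpow_of_nonneg _ ha.le, ENNReal.coe_rpow_of_nonneg _ hb.le] at this

/-- With both suprema equal to 1, the superlevel sets of `f` and `g` are nonempty at exactly the
same levels `s < 1`, so Brunn-Minkowski applies level by level. This gives the stronger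
arithmetic-mean bound. -/
lemma prekopa_leindler_of_iSup_eq_one {f g h : ℝ → ℝ≥0∞} (hf : Measurable f) (hg : Measurable g)
    (hh : Measurable h) (hf1 : ⨆ x, f x = 1) (hg1 : ⨆ x, g x = 1) {a b : ℝ} (ha : 0 < a)
    (hb : 0 < b) (hab : a + b = 1) (H : ∀ x y, f x ^ a * g y ^ b ≤ h (a * x + b * y)) :
    (∫⁻ x, f x) ^ a * (∫⁻ x, g x) ^ b ≤ ∫⁻ x, h x := by
  refine (ENNReal.geom_mean_le_arith_mean2 ha hb hab _ _).trans ?_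
  rw [lintegral_eq_lintegral_superlevel _ hf, lintegral_eq_lintegral_superlevel _ hg,
    lintegral_eq_lintegral_superlevel _ hh, ← lintegral_const_mul' _ _ ENNReal.ofReal_ne_top,
    ← lintegral_const_mul' _ _ ENNReal.ofReal_ne_top]
  have hanti : ∀ f : ℝ → ℝ≥0∞, Measurable fun s : ℝ => volume {u | ENNReal.ofReal s < f u} := by
    intro f
    refine Antitone.measurable fun s t hst => measure_mono fun u hu => ?_
    exact (ENNReal.ofReal_le_ofReal hst).trans_lt hu
  rw [← lintegral_add_left ((hanti f).const_mul _)]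
  refine setLIntegral_mono (hanti h) fun s hs => ?_
  rcases lt_or_ge s 1 with hs1 | hs1
  · refine volume_smul_add_volume_smul_le (measurableSet_lt measurable_const hf)
      (measurableSet_lt measurable_const hg) ?_ ?_ ha hb ?_
    · exact lt_iSup_iff.1 (hf1 ▸ ENNReal.ofReal_lt_one.2 hs1)
    · exact lt_iSup_iff.1 (hg1 ▸ ENNReal.ofReal_lt_one.2 hs1)
    · intro x hx y hy
      refine lt_of_lt_of_le ?_ (H x y)
      have hs0 : ENNReal.ofReal s ≠ 0 := by simpa using hs
      calc ENNReal.ofReal s = ENNReal.ofReal s ^ a * ENNReal.ofReal s ^ b := by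
            rw [← ENNReal.rpow_add _ _ hs0 ENNReal.ofReal_ne_top, hab, ENNReal.rpow_one]
        _ < f x ^ a * g y ^ b :=
            ENNReal.mul_lt_mul (ENNReal.rpow_lt_rpow hx ha) (ENNReal.rpow_lt_rpow hy hb)
  · have h1 : ∀ f : ℝ → ℝ≥0∞, ⨆ x, f x = 1 → {u | ENNReal.ofReal s < f u} = ∅ := by
      intro f hf
      ext u
      simp only [Set.mem_ofPred_eq, Set.mem_empty_iff_false, iff_false, not_lt]
      exact (le_iSup f u).trans (hf.le.trans (by simpa using hs1))
    simp [h1 f hf1, h1 g hg1]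

/-- The one-dimensional Prékopa-Leindler inequality for bounded functions. -/
lemma prekopa_leindler {f g h : ℝ → ℝ≥0∞} (hf : Measurable f) (hg : Measurable g)
    (hh : Measurable h) (hf1 : ⨆ x, f x ≠ ⊤) (hg1 : ⨆ x, g x ≠ ⊤) {a b : ℝ} (ha : 0 < a)
    (hb : 0 < b) (hab : a + b = 1) (H : ∀ x y, f x ^ a * g y ^ b ≤ h (a * x + b * y)) :
    (∫⁻ x, f x) ^ a * (∫⁻ x, g x) ^ b ≤ ∫⁻ x, h x := by
  set M := ⨆ x, f x with hM
  set L := ⨆ x, g x with hL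
  rcases eq_or_ne M 0 with hM0 | hM0
  · have : ∀ x, f x = 0 := by simpa [hM] using hM0
    simp [this, ha]
  rcases eq_or_ne L 0 with hL0 | hL0
  · have : ∀ x, g x = 0 := by simpa [hL] using hL0
    simp [this, hb]
  have hMa : M ^ a ≠ 0 := by simp [hM0, hf1]
  have hMa' : M ^ a ≠ ⊤ := by simp [hM0, hf1]
  have hLb : L ^ b ≠ 0 := by simp [hL0, hg1]
  have hLb' : L ^ b ≠ ⊤ := by simp [hL0, hg1]
  have key := prekopa_leindler_of_iSup_eq_one (f := fun x => M⁻¹ * f x) (g := fun x => L⁻¹ * g x)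
    (h := fun x => (M ^ a)⁻¹ * (L ^ b)⁻¹ * h x) (hf.const_mul _) (hg.const_mul _) (hh.const_mul _)
    (by rw [← ENNReal.mul_iSup, ← hM, ENNReal.inv_mul_cancel hM0 hf1])
    (by rw [← ENNReal.mul_iSup, ← hL, ENNReal.inv_mul_cancel hL0 hg1]) ha hb hab ?_
  · rw [lintegral_const_mul _ hf, lintegral_const_mul _ hg, lintegral_const_mul _ hh,
      ENNReal.mul_rpow_of_nonneg _ _ ha.le, ENNReal.mul_rpow_of_nonneg _ _ hb.le,
      ENNReal.inv_rpow, ENNReal.inv_rpow, mul_mul_mul_comm] at key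
    refine (ENNReal.mul_le_mul_iff_right ?_ ?_).1 key
    · simp [hMa', hLb']
    · exact ENNReal.mul_ne_top (ENNReal.inv_ne_top.2 hMa) (ENNReal.inv_ne_top.2 hLb)
  · intro x y
    rw [ENNReal.mul_rpow_of_nonneg _ _ ha.le, ENNReal.mul_rpow_of_nonneg _ _ hb.le,
      ENNReal.inv_rpow, ENNReal.inv_rpow, mul_mul_mul_comm]
    gcongr
    exact H x y

/-! ### Even log-concave functions, unimodal densities and their slices. -/

/-- A bounded measurable even function on `ι → ℝ` which is log-concave. -/
structure IsEvenLogConcave {ι : Type*} (F : (ι → ℝ) → ℝ≥0∞) : Prop where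
  measurable : Measurable F
  iSup_ne_top : ⨆ x, F x ≠ ⊤
  neg : ∀ x, F (-x) = F x
  rpow_mul_rpow_le : ∀ x y (a b : ℝ), 0 < a → 0 < b → a + b = 1 →
    F x ^ a * F y ^ b ≤ F (a • x + b • y)

/-- An integrable symmetric unimodal density. -/
structure IsSymmUnimodal (f : ℝ → ℝ≥0∞) : Prop where
  measurable : Measurable f
  lintegral_ne_top : ∫⁻ x, f x ≠ ⊤
  anti : ∀ x y, |x| ≤ |y| → f y ≤ f x

/-- A measurable even quasi-concave function on `ι → ℝ`. -/
structure IsEvenQuasiconcave {ι : Type*} (H : (ι → ℝ) → ℝ≥0∞) : Prop where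
  measurable : Measurable H
  neg : ∀ x, H (-x) = H x
  min_le : ∀ x y (a b : ℝ), 0 < a → 0 < b → a + b = 1 → min (H x) (H y) ≤ H (a • x + b • y)

namespace IsEvenLogConcave

variable {ι : Type*}

/-- The point `t • x` is the convex combination of `x` and `-x` with weights `(1 ± t) / 2`. -/
lemma le_smul {F : (ι → ℝ) → ℝ≥0∞} (hF : IsEvenLogConcave F) (x : ι → ℝ) {t : ℝ}
    (ht : |t| ≤ 1) : F x ≤ F (t • x) := by
  obtain ⟨h1, h2⟩ := abs_le.1 ht
  rcases h1.eq_or_lt with rfl | h1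
  · simp [hF.neg]
  rcases h2.eq_or_lt with rfl | h2
  · simp
  have key := hF.rpow_mul_rpow_le x (-x) ((1 + t) / 2) ((1 - t) / 2) (by linarith) (by linarith)
    (by ring)
  have hx : ((1 + t) / 2) • x + ((1 - t) / 2) • (-x) = t • x := by
    ext i
    simp only [Pi.add_apply, Pi.smul_apply, Pi.neg_apply, smul_eq_mul]
    ring
  rw [hx, hF.neg, ← ENNReal.rpow_add_of_nonneg _ _ (by linarith) (by linarith)] at key
  convert key using 1
  rw [show (1 + t) / 2 + (1 - t) / 2 = 1 by ring, ENNReal.rpow_one]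

/-- Prékopa's theorem: integrating out one coordinate preserves log-concavity. -/
lemma setLIntegral_update [DecidableEq ι] {F : (ι → ℝ) → ℝ≥0∞} (hF : IsEvenLogConcave F) (j : ι)
    {A : Set ℝ} (hA : MeasurableSet A) (hconv : Convex ℝ A) (hsymm : ∀ u, -u ∈ A ↔ u ∈ A)
    (hfin : volume A ≠ ⊤) :
    IsEvenLogConcave fun x => ∫⁻ u in A, F (Function.update x j u) where
  measurable := by
    refine Measurable.lintegral_prod_right'
      (f := fun z : (ι → ℝ) × ℝ => F (Function.update z.1 j z.2)) ?_
    exact hF.measurable.comp measurable_update'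
  iSup_ne_top := by
    refine ne_top_of_le_ne_top (ENNReal.mul_ne_top hF.iSup_ne_top hfin) (iSup_le fun x => ?_)
    rw [← setLIntegral_const]
    exact lintegral_mono fun u => le_iSup F _
  neg x := by
    rw [← lintegral_indicator hA, ← lintegral_indicator hA, ← lintegral_neg_eq_self]
    refine lintegral_congr fun u => ?_
    have : Function.update (-x) j (-u) = -Function.update x j u := by
      ext i
      by_cases h : i = j
      · subst h; simp
      · simp [h]
    by_cases h : u ∈ A
    · simp [h, (hsymm u).2 h, this, hF.neg]
    · simp [h, mt (hsymm u).1 h]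
  rpow_mul_rpow_le x y a b ha hb hab := by
    have hmeas : ∀ x, Measurable (A.indicator fun u => F (Function.update x j u)) := fun x =>
      (hF.measurable.comp (measurable_update x)).indicator hA
    have hbdd : ∀ x, ⨆ u, A.indicator (fun u => F (Function.update x j u)) u ≠ ⊤ := fun x =>
      ne_top_of_le_ne_top hF.iSup_ne_top
        (iSup_le fun u => (Set.indicator_le_self _ _ u).trans (le_iSup F _))
    simp only [← lintegral_indicator hA]
    refine prekopa_leindler (hmeas _) (hmeas _) (hmeas _) (hbdd _) (hbdd _) ha hb hab ?_
    intro u w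
    by_cases hu : u ∈ A
    · by_cases hw : w ∈ A
      · have huw : a * u + b * w ∈ A := hconv hu hw ha.le hb.le hab
        have : Function.update (a • x + b • y) j (a * u + b * w) =
            a • Function.update x j u + b • Function.update y j w := by
          ext i
          by_cases h : i = j
          · subst h; simp
          · simp [h]
        simp only [Set.indicator, hu, hw, huw, if_true, this]
        exact hF.rpow_mul_rpow_le _ _ a b ha hb hab
      · simp [hw, hb]
    · simp [hu, ha]

end IsEvenLogConcave

namespace IsSymmUnimodal

variable {f : ℝ → ℝ≥0∞}

lemma measurableSet_superlevel (hf : IsSymmUnimodal f) (c : ℝ≥0∞) :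
    MeasurableSet {u | c < f u} :=
  measurableSet_lt measurable_const hf.measurable

lemma convex_superlevel (hf : IsSymmUnimodal f) (c : ℝ≥0∞) : Convex ℝ {u | c < f u} := by
  intro x hx y hy a b ha hb hab
  have habs : |a • x + b • y| ≤ max |x| |y| := by
    calc |a • x + b • y| ≤ |a * x| + |b * y| := abs_add_le _ _
      _ = a * |x| + b * |y| := by rw [abs_mul, abs_mul, abs_of_nonneg ha, abs_of_nonneg hb]
      _ ≤ a * max |x| |y| + b * max |x| |y| := by gcongr <;> simp
      _ = max |x| |y| := by rw [← add_mul, hab, one_mul]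
  rcases le_total |x| |y| with h | h
  · exact lt_of_lt_of_le hy (hf.anti _ _ (habs.trans (max_eq_right h).le))
  · exact lt_of_lt_of_le hx (hf.anti _ _ (habs.trans (max_eq_left h).le))

lemma neg_mem_superlevel (hf : IsSymmUnimodal f) (c : ℝ≥0∞) (u : ℝ) :
    -u ∈ {u | c < f u} ↔ u ∈ {u | c < f u} := by
  have : f (-u) = f u := le_antisymm (hf.anti _ _ (by simp)) (hf.anti _ _ (by simp))
  simp [this]

/-- Markov's inequality; finiteness keeps the slices in `IsEvenLogConcave.setLIntegral_update`
bounded. -/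
lemma volume_superlevel_ne_top (hf : IsSymmUnimodal f) {c : ℝ≥0∞} (hc : c ≠ 0) (hc' : c ≠ ⊤) :
    volume {u | c < f u} ≠ ⊤ := by
  refine ne_top_of_le_ne_top (ENNReal.div_ne_top hf.lintegral_ne_top hc)
    (le_trans (measure_mono fun u (hu : c < f u) => hu.le)
      (meas_ge_le_lintegral_div hf.measurable.aemeasurable hc hc'))

lemma isFiniteMeasure_withDensity (hf : IsSymmUnimodal f) :
    IsFiniteMeasure ((volume : Measure ℝ).withDensity f) :=
  MeasureTheory.isFiniteMeasure_withDensity hf.lintegral_ne_top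

lemma lintegral_withDensity (hf : IsSymmUnimodal f) {g : ℝ → ℝ≥0∞} (hg : Measurable g) :
    ∫⁻ u, g u ∂(volume : Measure ℝ).withDensity f =
      ∫⁻ s in Set.Ioi (0 : ℝ), ∫⁻ u in {u | ENNReal.ofReal s < f u}, g u := by
  rw [lintegral_withDensity_eq_lintegral_mul _ hf.measurable hg,
    ← lintegral_mul_eq_lintegral_superlevel _ hf.measurable hg]
  rfl

end IsSymmUnimodal

/-- Superlevel sets are convex and symmetric. Passing to them is needed because log-concavity,
unlike quasi-concavity, survives marginalisation. -/
lemma IsEvenQuasiconcave.isEvenLogConcave_indicator {ι : Type*} {H : (ι → ℝ) → ℝ≥0∞}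
    (hH : IsEvenQuasiconcave H) (c : ℝ≥0∞) :
    IsEvenLogConcave ({y | c < H y}.indicator 1) where
  measurable := measurable_one.indicator (measurableSet_lt measurable_const hH.measurable)
  iSup_ne_top := by
    refine ne_top_of_le_ne_top ENNReal.one_ne_top (iSup_le fun x => ?_)
    exact Set.indicator_le_self _ _ x
  neg x := by simp [Set.indicator, hH.neg]
  rpow_mul_rpow_le x y a b ha hb hab := by
    by_cases hx : c < H x
    · by_cases hy : c < H y
      · have : c < H (a • x + b • y) := (lt_min hx hy).trans_le (hH.min_le x y a b ha hb hab)
        simp [Set.indicator, hx, hy, this]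
      · simp [Set.indicator, hy, hb]
    · simp [Set.indicator, hx, ha]

/-! ### Anderson's theorem. -/

section Marginal

variable {ι : Type*} [DecidableEq ι]

lemma lmarginal_lintegral {S : Finset ι} (μ : ι → Measure ℝ) [∀ j, SigmaFinite (μ j)]
    {α : Type*} [MeasurableSpace α] (ν : Measure α) [SFinite ν] {G : α → (ι → ℝ) → ℝ≥0∞}
    (hG : Measurable fun z : α × (ι → ℝ) => G z.1 z.2) (x : ι → ℝ) :
    lmarginal μ S (fun y => ∫⁻ s, G s y ∂ν) x = ∫⁻ s, lmarginal μ S (G s) x ∂ν := by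
  simp only [lmarginal]
  refine lintegral_lintegral_swap (Measurable.aemeasurable ?_)
  exact hG.comp (measurable_snd.prodMk (measurable_updateFinset.comp measurable_fst))

/-- A form of Anderson's theorem for products of symmetric unimodal densities. -/
lemma IsEvenLogConcave.lmarginal_le_lmarginal_smul {f : ι → ℝ → ℝ≥0∞}
    (hf : ∀ j, IsSymmUnimodal (f j)) (S : Finset ι) {H : (ι → ℝ) → ℝ≥0∞}
    (hH : IsEvenLogConcave H) (x : ι → ℝ) {t : ℝ} (ht : |t| ≤ 1) :
    lmarginal (fun j => (volume : Measure ℝ).withDensity (f j)) S H x ≤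
      lmarginal (fun j => (volume : Measure ℝ).withDensity (f j)) S H (t • x) := by
  have := fun j => (hf j).isFiniteMeasure_withDensity
  induction S using Finset.induction_on generalizing H with
  | empty => simpa using hH.le_smul x ht
  | insert j S hj ih =>
    rw [lmarginal_insert' _ hH.measurable hj]
    -- The density is a mixture of uniform weights on symmetric convex sets, so each slice is again
    -- even log-concave and the induction hypothesis applies to it.
    have hswap : (fun x => ∫⁻ u, H (Function.update x j u) ∂(volume : Measure ℝ).withDensity (f j)) =
        fun x => ∫⁻ s in Set.Ioi (0 : ℝ),
          ∫⁻ u in {u | ENNReal.ofReal s < f j u}, H (Function.update x j u) := by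
      funext x
      exact (hf j).lintegral_withDensity (hH.measurable.comp (measurable_update x))
    have hmeas : Measurable fun z : ℝ × (ι → ℝ) =>
        ∫⁻ u in {u | ENNReal.ofReal z.1 < f j u}, H (Function.update z.2 j u) := by
      simp only [← lintegral_indicator ((hf j).measurableSet_superlevel _)]
      refine Measurable.lintegral_prod_right' (f := fun w : (ℝ × (ι → ℝ)) × ℝ =>
        {u | ENNReal.ofReal w.1.1 < f j u}.indicator
          (fun u => H (Function.update w.1.2 j u)) w.2) ?_
      have hset : MeasurableSet {w : (ℝ × (ι → ℝ)) × ℝ | ENNReal.ofReal w.1.1 < f j w.2} :=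
        measurableSet_lt (by fun_prop) ((hf j).measurable.comp measurable_snd)
      have hH' : Measurable fun w : (ℝ × (ι → ℝ)) × ℝ => H (Function.update w.1.2 j w.2) :=
        hH.measurable.comp
          (measurable_update'.comp ((measurable_snd.comp measurable_fst).prodMk measurable_snd))
      exact hH'.indicator hset
    rw [hswap, lmarginal_lintegral _ _ hmeas, lmarginal_lintegral _ _ hmeas]
    refine setLIntegral_mono' measurableSet_Ioi fun s hs => ih ?_
    refine hH.setLIntegral_update j ((hf j).measurableSet_superlevel _)
      ((hf j).convex_superlevel _) ((hf j).neg_mem_superlevel _)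
      ((hf j).volume_superlevel_ne_top ?_ ENNReal.ofReal_ne_top)
    simpa using hs

lemma IsEvenQuasiconcave.lmarginal_le_lmarginal_smul {f : ι → ℝ → ℝ≥0∞}
    (hf : ∀ j, IsSymmUnimodal (f j)) (S : Finset ι) {H : (ι → ℝ) → ℝ≥0∞}
    (hH : IsEvenQuasiconcave H) (x : ι → ℝ) {t : ℝ} (ht : |t| ≤ 1) :
    lmarginal (fun j => (volume : Measure ℝ).withDensity (f j)) S H x ≤
      lmarginal (fun j => (volume : Measure ℝ).withDensity (f j)) S H (t • x) := by
  have := fun j => (hf j).isFiniteMeasure_withDensity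
  have hlayer : H = fun y => ∫⁻ s in Set.Ioi (0 : ℝ),
      {y | ENNReal.ofReal s < H y}.indicator 1 y := by
    funext y
    exact (ENNReal.lintegral_Ioi_indicator_lt (H y)).symm
  have hmeas : Measurable fun z : ℝ × (ι → ℝ) =>
      {y | ENNReal.ofReal z.1 < H y}.indicator (1 : (ι → ℝ) → ℝ≥0∞) z.2 := by
    have hset : MeasurableSet {z : ℝ × (ι → ℝ) | ENNReal.ofReal z.1 < H z.2} :=
      measurableSet_lt (by fun_prop) (hH.measurable.comp measurable_snd)
    exact measurable_one.indicator hset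
  rw [hlayer, lmarginal_lintegral _ _ hmeas, lmarginal_lintegral _ _ hmeas]
  exact lintegral_mono fun s =>
    (hH.isEvenLogConcave_indicator _).lmarginal_le_lmarginal_smul hf S x ht

end Marginal

/-! ### Single crossing and peakedness. -/

/-- Formally `(g - f) * (φ - c) ≥ 0` pointwise while `g - f` integrates to 0. Since subtraction in
`ℝ≥0∞` truncates, `φ` is split as `min φ c + (φ - c)`. -/
lemma lintegral_mul_le_lintegral_mul_of_crossing {α : Type*} [MeasurableSpace α] {μ : Measure α}
    {f g φ : α → ℝ≥0∞} (hf : Measurable f) (hg : Measurable g) (hφ : Measurable φ)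
    (hfg : ∫⁻ x, f x ∂μ = ∫⁻ x, g x ∂μ) (hfin : ∫⁻ x, f x ∂μ ≠ ⊤) {S : Set α}
    (hS : MeasurableSet S) (hgS : ∫⁻ x in S, g x ∂μ ≠ 0) {c : ℝ≥0∞}
    (h1 : ∀ x ∈ S, f x ≤ g x) (h2 : ∀ x ∉ S, g x ≤ f x) (h3 : ∀ x ∈ S, c ≤ φ x)
    (h4 : ∀ x ∉ S, φ x ≤ c) :
    ∫⁻ x, f x * φ x ∂μ ≤ ∫⁻ x, g x * φ x ∂μ := by
  -- If `c = ⊤`, then `φ = ⊤` on `S`, where `g` has mass, and the right side is infinite.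
  rcases eq_or_ne c ⊤ with rfl | hc
  · have : ∫⁻ x, g x * φ x ∂μ = ⊤ := by
      refine top_unique ?_
      calc ⊤ = ∫⁻ x in S, g x * ⊤ ∂μ := by
            rw [lintegral_mul_const _ hg, ENNReal.mul_top hgS]
        _ ≤ ∫⁻ x in S, g x * φ x ∂μ := by
            refine setLIntegral_mono' hS fun x hx => ?_
            gcongr
            exact h3 x hx
        _ ≤ ∫⁻ x, g x * φ x ∂μ := setLIntegral_le_lintegral _ _
    rw [this]
    exact le_top
  have hmeas : ∀ f : α → ℝ≥0∞, Measurable f → Measurable fun x => f x * min (φ x) c :=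
    fun f hf => hf.mul (hφ.min measurable_const)
  have hsplit : ∀ f : α → ℝ≥0∞, Measurable f → ∫⁻ x, f x * φ x ∂μ =
      ∫⁻ x, f x * min (φ x) c ∂μ + ∫⁻ x, f x * (φ x - c) ∂μ := by
    intro f hf
    rw [← lintegral_add_left (hmeas f hf)]
    refine lintegral_congr fun x => ?_
    rw [← mul_add]
    congr 1
    rcases le_total (φ x) c with h | h
    · simp [h, tsub_eq_zero_of_le h]
    · simp [h, add_tsub_cancel_of_le h]
  -- Equal masses turn the comparison of the `min` parts into the reversed comparison of the
  -- deficits `c - φ`.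
  have hsplit' : ∀ f : α → ℝ≥0∞, Measurable f → (∫⁻ x, f x ∂μ) * c =
      ∫⁻ x, f x * min (φ x) c ∂μ + ∫⁻ x, f x * (c - φ x) ∂μ := by
    intro f hf
    rw [← lintegral_mul_const _ hf, ← lintegral_add_left (hmeas f hf)]
    refine lintegral_congr fun x => ?_
    rw [← mul_add]
    congr 1
    rcases le_total (φ x) c with h | h
    · simp [h, add_tsub_cancel_of_le h]
    · simp [h, tsub_eq_zero_of_le h]
  rw [hsplit f hf, hsplit g hg]
  refine add_le_add ?_ (lintegral_mono fun x => ?_)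
  · have hB : ∫⁻ x, g x * (c - φ x) ∂μ ≤ ∫⁻ x, f x * (c - φ x) ∂μ := by
      refine lintegral_mono fun x => ?_
      by_cases hx : x ∈ S
      · simp [tsub_eq_zero_of_le (h3 x hx)]
      · gcongr
        exact h2 x hx
    have hBfin : ∫⁻ x, g x * (c - φ x) ∂μ ≠ ⊤ := by
      refine ne_top_of_le_ne_top (ENNReal.mul_ne_top (hfg ▸ hfin) hc) ?_
      rw [hsplit' g hg]
      exact le_add_self
    refine (ENNReal.add_le_add_iff_right hBfin).1 ?_
    rw [← hsplit' g hg, ← hfg, hsplit' f hf]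
    gcongr
  · by_cases hx : x ∈ S
    · gcongr
      exact h1 x hx
    · simp [tsub_eq_zero_of_le (h4 x hx)]

lemma betaConst_pos {p : ℝ} (hp : 0 < p) : 0 < betaConst p := by
  have : 0 < Real.Gamma (1 + 1 / p) := Real.Gamma_pos_of_pos (by positivity)
  simpa [betaConst] using this

/-- The density of `expPowerMeasure p`. -/
noncomputable def expPowerDensity (p x : ℝ) : ℝ≥0∞ :=
  ENNReal.ofReal (Real.exp (-(betaConst p ^ p * |x| ^ p)))

lemma expPowerMeasure_eq (p : ℝ) :
    expPowerMeasure p = (volume : Measure ℝ).withDensity (expPowerDensity p) := rfl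

lemma measurable_expPowerDensity (p : ℝ) : Measurable (expPowerDensity p) := by
  unfold expPowerDensity
  fun_prop

lemma isSymmUnimodal_expPowerDensity {p : ℝ} (hp : 0 < p)
    (h : IsProbabilityMeasure (expPowerMeasure p)) : IsSymmUnimodal (expPowerDensity p) where
  measurable := measurable_expPowerDensity p
  lintegral_ne_top := by
    have := h.measure_univ
    rw [expPowerMeasure_eq, withDensity_apply _ MeasurableSet.univ, Measure.restrict_univ] at this
    simp [this]
  anti x y hxy := by
    unfold expPowerDensity
    have := betaConst_pos hp
    gcongr

/-- The ratio of the two sides is a multiple of `x ^ (p' - p)`, increasing, and equal to 1 at `r =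
(B / B') ^ (1 / (p' - p))`. -/
lemma exists_crossing_mul_rpow {B B' p p' : ℝ} (hB : 0 < B) (hB' : 0 < B') (hp : 0 < p)
    (hpp : p < p') :
    ∃ r : ℝ, 0 < r ∧ (∀ x, 0 ≤ x → x ≤ r → B' * x ^ p' ≤ B * x ^ p) ∧
      (∀ x, r ≤ x → B * x ^ p ≤ B' * x ^ p') := by
  have hd : 0 < p' - p := sub_pos.2 hpp
  have hr : 0 < (B / B') ^ (1 / (p' - p)) := by positivity
  have hrp : ((B / B') ^ (1 / (p' - p))) ^ (p' - p) = B / B' := by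
    rw [← Real.rpow_mul (by positivity), one_div_mul_cancel hd.ne', Real.rpow_one]
  have hsplit : ∀ x : ℝ, 0 < x → x ^ p' = x ^ p * x ^ (p' - p) := by
    intro x hx
    rw [← Real.rpow_add hx]
    congr 1
    ring
  refine ⟨_, hr, fun x hx0 hx => ?_, fun x hx => ?_⟩
  · rcases hx0.eq_or_lt with rfl | hx0
    · simp [Real.zero_rpow hp.ne', Real.zero_rpow (hp.trans hpp).ne']
    · have h := Real.rpow_le_rpow hx0.le hx hd.le
      rw [hrp, le_div_iff₀ hB'] at h
      rw [hsplit x hx0]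
      nlinarith [Real.rpow_pos_of_pos hx0 p]
  · have hx0 : 0 < x := hr.trans_le hx
    have h := Real.rpow_le_rpow hr.le hx hd.le
    rw [hrp, div_le_iff₀ hB'] at h
    rw [hsplit x hx0]
    nlinarith [Real.rpow_pos_of_pos hx0 p]

/-- The laws `expPowerMeasure p` become more peaked at the origin as `p` grows. -/
lemma lintegral_expPowerMeasure_mono {p p' : ℝ} (hp : 0 < p) (hpp : p ≤ p')
    (h : IsProbabilityMeasure (expPowerMeasure p)) (h' : IsProbabilityMeasure (expPowerMeasure p'))
    {φ : ℝ → ℝ≥0∞} (hφ : Measurable φ) (hanti : ∀ x y, |x| ≤ |y| → φ y ≤ φ x) :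
    ∫⁻ x, φ x ∂expPowerMeasure p ≤ ∫⁻ x, φ x ∂expPowerMeasure p' := by
  rcases hpp.eq_or_lt with rfl | hpp
  · exact le_rfl
  have hone : ∀ q, IsProbabilityMeasure (expPowerMeasure q) → ∫⁻ x, expPowerDensity q x = 1 := by
    intro q hq
    have := hq.measure_univ
    rwa [expPowerMeasure_eq, withDensity_apply _ MeasurableSet.univ, Measure.restrict_univ] at this
  have hβ := betaConst_pos hp
  have hβ' := betaConst_pos (hp.trans hpp)
  obtain ⟨r, hr, hr1, hr2⟩ := exists_crossing_mul_rpow (Real.rpow_pos_of_pos hβ p)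
    (Real.rpow_pos_of_pos hβ' p') hp hpp
  rw [expPowerMeasure_eq, expPowerMeasure_eq,
    lintegral_withDensity_eq_lintegral_mul _ (measurable_expPowerDensity p) hφ,
    lintegral_withDensity_eq_lintegral_mul _ (measurable_expPowerDensity p') hφ]
  refine lintegral_mul_le_lintegral_mul_of_crossing (measurable_expPowerDensity p)
    (measurable_expPowerDensity p') hφ ((hone p h).trans (hone p' h').symm)
    (by simp [hone p h]) (S := {x | |x| ≤ r}) (c := φ r)
    (measurableSet_le (by fun_prop) measurable_const) ?_ ?_ ?_ ?_ ?_
  · refine (setLIntegral_pos_iff (measurable_expPowerDensity p')).2 ?_ |>.ne'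
    have hsupp : Function.support (expPowerDensity p') = Set.univ := by
      ext x
      simp [expPowerDensity, Real.exp_pos]
    have hball : {x : ℝ | |x| ≤ r} = Set.Icc (-r) r := by
      ext x
      simp [abs_le]
    rw [hsupp, Set.univ_inter, hball, Real.volume_Icc]
    simpa using hr
  · intro x hx
    exact ENNReal.ofReal_le_ofReal (Real.exp_le_exp.2 (neg_le_neg (hr1 _ (abs_nonneg x) hx)))
  · intro x hx
    exact ENNReal.ofReal_le_ofReal (Real.exp_le_exp.2 (neg_le_neg (hr2 _ (not_le.1 hx).le)))
  · intro x hx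
    exact hanti _ _ (by simpa [abs_of_pos hr] using hx)
  · intro x hx
    exact hanti _ _ (by simpa [abs_of_pos hr] using (not_le.1 hx).le)

/-! ### Application to powers of the norm. -/

/-- The seminorm is even and convex, and a negative power reverses order on `[0, ∞]`. -/
lemma isEvenQuasiconcave_seminorm_rpow {n k : ℕ} (N : Seminorm ℝ (EuclideanSpace ℝ (Fin k)))
    (v : Fin n → EuclideanSpace ℝ (Fin k)) {q : ℝ} (hq : q < 0) :
    IsEvenQuasiconcave fun y : Fin n → ℝ => ENNReal.ofReal (N (∑ j, y j • v j)) ^ q where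
  measurable := by
    have hN : Continuous N := continuousOn_univ.1 (N.convexOn.continuousOn isOpen_univ)
    have : Measurable fun y : Fin n → ℝ => N (∑ j, y j • v j) :=
      (hN.comp (by fun_prop)).measurable
    fun_prop
  neg x := by
    have : ∑ j, (-x) j • v j = -∑ j, x j • v j := by simp
    rw [this, map_neg_eq_map]
  min_le x y a b ha hb hab := by
    have hlin : ∑ j, (a • x + b • y) j • v j = a • ∑ j, x j • v j + b • ∑ j, y j • v j := by
      simp [add_smul, mul_smul, Finset.sum_add_distrib, Finset.smul_sum]
    rw [hlin]
    have hle := N.convexOn.le_max_of_mem_segment (Set.mem_univ (∑ j, x j • v j))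
      (Set.mem_univ (∑ j, y j • v j)) ⟨a, b, ha.le, hb.le, hab, rfl⟩
    have hmono : ∀ s t : ℝ, s ≤ t → ENNReal.ofReal t ^ q ≤ ENNReal.ofReal s ^ q := by
      intro s t hst
      rw [← neg_neg q, ENNReal.rpow_neg _ (-q), ENNReal.rpow_neg _ (-q), ENNReal.inv_le_inv]
      exact ENNReal.rpow_le_rpow (ENNReal.ofReal_le_ofReal hst) (by linarith)
    rcases le_max_iff.1 hle with h | h
    · exact (min_le_left _ _).trans (hmono _ _ h)
    · exact (min_le_right _ _).trans (hmono _ _ h)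

lemma expNormPow_eq_lintegral {n k : ℕ} (N : Seminorm ℝ (EuclideanSpace ℝ (Fin k)))
    (v : Fin n → EuclideanSpace ℝ (Fin k)) {q : ℝ} (hq : q < 0) {Ω : Type*} [MeasurableSpace Ω]
    (P : Measure Ω) [IsProbabilityMeasure P] {X : Fin n → Ω → ℝ} {μ : Fin n → Measure ℝ}
    (hlaw : ∀ j, HasLaw (X j) (μ j) P) (hindep : iIndepFun X P) :
    expNormPow P N v q X =
      ∫⁻ y, ENNReal.ofReal (N (∑ j, y j • v j)) ^ q ∂Measure.pi μ := by
  have hmap := (iIndepFun_iff_map_fun_eq_pi_map fun j => (hlaw j).aemeasurable).1 hindep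
  simp only [fun j => (hlaw j).map_eq] at hmap
  rw [← hmap, lintegral_map' (isEvenQuasiconcave_seminorm_rpow N v hq).measurable.aemeasurable
    (aemeasurable_pi_lambda _ fun j => (hlaw j).aemeasurable)]
  rfl

/-- Integrals of even quasi-concave functions grow when one factor becomes more peaked. -/
lemma IsEvenQuasiconcave.lintegral_pi_mono {n : ℕ} {H : (Fin n → ℝ) → ℝ≥0∞}
    (hH : IsEvenQuasiconcave H) (hprob : ∀ p, 0 < p → IsProbabilityMeasure (expPowerMeasure p))
    {p p' : Fin n → ℝ} (hp : ∀ j, 0 < p j) (hp' : ∀ j, 0 < p' j) (i : Fin n)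
    (heq : ∀ j, j ≠ i → p j = p' j) (hle : p i ≤ p' i) :
    ∫⁻ y, H y ∂Measure.pi (fun j => expPowerMeasure (p j)) ≤
      ∫⁻ y, H y ∂Measure.pi (fun j => expPowerMeasure (p' j)) := by
  have := fun j => hprob (p j) (hp j)
  have := fun j => hprob (p' j) (hp' j)
  have hcongr : lmarginal (fun j => expPowerMeasure (p j)) (Finset.univ.erase i) H =
      lmarginal (fun j => expPowerMeasure (p' j)) (Finset.univ.erase i) H := by
    have : (fun j : (Finset.univ.erase i : Finset (Fin n)) => expPowerMeasure (p j)) =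
        fun j : (Finset.univ.erase i : Finset (Fin n)) => expPowerMeasure (p' j) := by
      funext j
      rw [heq j (Finset.ne_of_mem_erase j.2)]
    funext x
    simp only [lmarginal]
    rw [this]
  -- Base point 0 makes the remaining variable run along a line through the origin, as the scaling
  -- form of Anderson's theorem requires.
  rw [lintegral_eq_lmarginal_univ (0 : Fin n → ℝ), lintegral_eq_lmarginal_univ (0 : Fin n → ℝ),
    lmarginal_erase _ hH.measurable (Finset.mem_univ i),
    lmarginal_erase _ hH.measurable (Finset.mem_univ i), ← hcongr]
  refine lintegral_expPowerMeasure_mono (hp i) hle inferInstance inferInstance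
    ((hH.measurable.lmarginal _).comp (measurable_update _)) fun x y hxy => ?_
  -- If `y = 0` then `x = 0`, and the convention `0 / 0 = 0` still gives a valid factor.
  have ht : |x / y| ≤ 1 := by
    rw [abs_div]
    exact div_le_one_of_le₀ hxy (abs_nonneg y)
  have hx : Function.update (0 : Fin n → ℝ) i x = (x / y) • Function.update (0 : Fin n → ℝ) i y := by
    have hxy' : x / y * y = x := by
      refine div_mul_cancel_of_imp fun hy => ?_
      simpa [hy] using hxy
    ext j
    by_cases h : j = i
    · subst h; simp [hxy']
    · simp [h]
  rw [hx]
  exact hH.lmarginal_le_lmarginal_smul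
    (fun j => isSymmUnimodal_expPowerDensity (hp j) inferInstance) _ _ ht

end

theorem mainTheorem6 {n k : ℕ}
    -- an arbitrary norm `N` on `ℝ^k`
    (N : Seminorm ℝ (EuclideanSpace ℝ (Fin k))) (hN : ∀ x, N x = 0 → x = 0)
    (v : Fin n → EuclideanSpace ℝ (Fin k)) (q : ℝ) (hkq : -(k : ℝ) < q) (hq : q < 0)
    {Ω : Type*} [MeasurableSpace Ω] (P : Measure Ω) [IsProbabilityMeasure P]
    -- `Y p j` is the random variable `Y_j^{(p)}`
    (Y : ℝ → Fin n → Ω → ℝ)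
    (hlaw : ∀ p : ℝ, 0 < p → ∀ j, HasLaw (Y p j) (expPowerMeasure p) P)
    (hindep : ∀ p : Fin n → ℝ, (∀ j, 0 < p j) → iIndepFun (fun j => Y (p j) j) P) :
    ∀ p : Fin n → ℝ, (∀ j, 0 < p j) → ∀ i : Fin n,
      MonotoneOn
        (fun t : ℝ => expNormPow P N v q (fun j => Y (Function.update p i t j) j))
        (Set.Ioi 0) := by
  intro p hp i s hs t ht hst
  have hpos : ∀ t ∈ Set.Ioi (0 : ℝ), ∀ j, 0 < Function.update p i t j := by
    intro t ht j
    by_cases h : j = i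
    · subst h; simpa using ht
    · simpa [h] using hp j
  -- Unit mass comes from being the law of a random variable, so no Gamma integral is computed.
  have hprob : ∀ p, 0 < p → IsProbabilityMeasure (expPowerMeasure p) := fun p hp =>
    (hlaw p hp i).map_eq ▸ Measure.isProbabilityMeasure_map (hlaw p hp i).aemeasurable
  have hexp : ∀ t ∈ Set.Ioi (0 : ℝ), _ := fun t ht =>
    expNormPow_eq_lintegral N v hq P (fun j => hlaw _ (hpos t ht j) j) (hindep _ (hpos t ht))
  simp only [hexp s hs, hexp t ht]
  refine (isEvenQuasiconcave_seminorm_rpow N v hq).lintegral_pi_mono hprob (hpos s hs) (hpos t ht)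
    i (fun j hj => ?_) ?_
  · simp [hj]
  · simpa using hst
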